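/- Let $d\ge 0$, let $\rho$ be a $d$-qubit density matrix and let $O$ be an observable, i.e. a Hermitian $2^d\times 2^d$ complex matrix, with operator norm $\|O\|_\infty$ and smallest and largest eigenvalues $\lambda_{\min}(O)$, $\lambda_{\max}(O)$. Put $\langle O\rangle_\rho=\operatorname{Tr}(\rho O)$. A random $2^d\times 2^d$ unitary matrix $U$ is drawn from one of the following two ensembles: - local Clifford: $U=U_1\otimes\cdots\otimes U_d$ with $U_1,\dots,U_d$ independent and uniform in the single-qubit Clifford group (modulo global phases); - joint Clifford: $U$ uniform in the $d$-qubit Clifford group (modulo global phases), i.e. the normalizer of the Pauli group in the unitary group. Given $U$, the POVM $\{U^\dagger|x\rangle\langle x|U\}_{x\in\{0,1\}^d}$ is measured in the state $\rho$, with outcome $X$: $\Pr[X=x\mid U]=\operatorname{Tr}(U^\dagger|x\rangle\langle x|U\rho)$. Let $\mathcal R$ be the measurement channel $\mathcal R(A)=\mathbb E_U\big[\sum_x\operatorname{Tr}(U^\dagger|x\rangle\langle x|UA)\,U^\dagger|x\rangle\langle x|U\big]$, a linear map on the $2^d\times 2^d$ matrices. Then, for both ensembles, $\mathcal R$ is invertible,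 and the classical-shadow estimate $$\hat o=\operatorname{Tr}(O\hat\rho),\qquad \hat\rho=\mathcal R^{-1}\big(U^\dagger|X\rangle\langle X|U\big),$$ is integrable and unbiased, $\mathbb E_{U,X}[\hat o]=\langle O\rangle_\rho$, and there are finite constants $l\le u$ such that $\hat o$ is almost surely real with $\hat o\in[l,u]$. Explicitly, one can take $$l=-3^{|S|}\|O\|_\infty,\qquad u=3^{|S|}\|O\|_\infty$$ for the local Clifford ensemble, where $S$ is the set of qubits on which $O$ acts non-trivially (that is, those $k$ for which $O$ is not of the form $A\otimes I$ with $I$ the identity on qubit $k$), and $$l=(2^d+1)\lambda_{\min}(O)-\operatorname{Tr}(O),\qquad u=(2^d+1)\lambda_{\max}(O)-\operatorname{Tr}(O)$$ for the joint Clifford ensemble. -/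

import Mathlib

open MeasureTheory ProbabilityTheory

namespace ClassicalShadow

/-! ### Qubits, tensor products, observables and states -/

/-- Bit strings of length `d`; they label the computational basis of `d` qubits. -/
abbrev Bits (d : ℕ) : Type := Fin d → Fin 2

/-- The `2 ^ d × 2 ^ d` complex matrices. -/
abbrev Mat (d : ℕ) : Type := Matrix (Bits d) (Bits d) ℂ

/-- The unitary `2 ^ d × 2 ^ d` matrices. -/
abbrev U (d : ℕ) : Type := Matrix.unitaryGroup (Bits d) ℂ

/-- The tensor (Kronecker) product of `d` single-qubit matrices. -/
def tensor {d : ℕ} (A : Fin d → Matrix (Fin 2) (Fin 2) ℂ) : Mat d :=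
  Matrix.of fun x y => ∏ k, A k (x k) (y k)

theorem tensor_mul {d : ℕ} (A B : Fin d → Matrix (Fin 2) (Fin 2) ℂ) :
    tensor A * tensor B = tensor fun k => A k * B k := by
  ext x y
  simp only [tensor, Matrix.mul_apply, Matrix.of_apply, ← Finset.prod_mul_distrib]
  rw [Finset.prod_univ_sum, Fintype.piFinset_univ]

theorem tensor_one {d : ℕ} : (tensor fun _ : Fin d => (1 : Matrix (Fin 2) (Fin 2) ℂ)) = 1 := by
  ext x y
  by_cases h : x = y
  · subst h; simp [tensor]
  · obtain ⟨k, hk⟩ := Function.ne_iff.mp h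
    simp only [tensor, Matrix.of_apply, Matrix.one_apply_ne h]
    exact Finset.prod_eq_zero (Finset.mem_univ k) (Matrix.one_apply_ne hk)

theorem tensor_star {d : ℕ} (A : Fin d → Matrix (Fin 2) (Fin 2) ℂ) :
    star (tensor A) = tensor fun k => star (A k) := by
  ext x y
  simp [tensor, Matrix.star_apply]

theorem tensor_smul {d : ℕ} (c : Fin d → ℂ) (A : Fin d → Matrix (Fin 2) (Fin 2) ℂ) :
    (tensor fun k => c k • A k) = (∏ k, c k) • tensor A := by
  ext x y
  simp [tensor, Finset.prod_mul_distrib]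

open scoped ComplexOrder in
/-- A density matrix: positive semidefinite with unit trace. -/
def IsDensityMatrix {d : ℕ} (ρ : Mat d) : Prop := ρ.PosSemidef ∧ ρ.trace = 1

/-- The operator norm of a matrix acting on the `2 ^ d`-dimensional Hilbert space. -/
noncomputable def opNorm {d : ℕ} (O : Mat d) : ℝ :=
  ‖Matrix.toEuclideanCLM (n := Bits d) (𝕜 := ℂ) O‖

/-- The largest eigenvalue of a Hermitian matrix. -/
noncomputable def eigMax {d : ℕ} {O : Mat d} (hO : O.IsHermitian) : ℝ := ⨆ i, hO.eigenvalues i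

/-- The smallest eigenvalue of a Hermitian matrix. -/
noncomputable def eigMin {d : ℕ} {O : Mat d} (hO : O.IsHermitian) : ℝ := ⨅ i, hO.eigenvalues i

/-- `O` acts trivially on the qubit `k`: it is the tensor product of a matrix on the other qubits
with the identity on qubit `k`. -/
def ActsTriviallyOn {d : ℕ} (O : Mat d) (k : Fin d) : Prop :=
  ∃ A : Matrix ({j : Fin d // j ≠ k} → Fin 2) ({j : Fin d // j ≠ k} → Fin 2) ℂ,
    ∀ x y : Bits d, O x y =
      A (fun j => x j) (fun j => y j) * (1 : Matrix (Fin 2) (Fin 2) ℂ) (x k) (y k)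

open Classical in
/-- The set of qubits on which `O` acts non-trivially. -/
noncomputable def support {d : ℕ} (O : Mat d) : Finset (Fin d) :=
  Finset.univ.filter fun k => ¬ ActsTriviallyOn O k

/-! ### The Pauli group and the Clifford group -/

/-- The single-qubit Pauli matrices `I, X, Y, Z`. -/
def pauli : Fin 4 → Matrix (Fin 2) (Fin 2) ℂ :=
  ![1, !![0, 1; 1, 0], !![0, -Complex.I; Complex.I, 0], !![1, 0; 0, -1]]

/-- Tensor products of single-qubit Pauli matrices. -/
def pauliString {d : ℕ} (s : Fin d → Fin 4) : Mat d := tensor fun k => pauli (s k)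

theorem pauli_star (a : Fin 4) : star (pauli a) = pauli a := by
  fin_cases a <;> ext i j <;> fin_cases i <;> fin_cases j <;> simp [pauli, Matrix.star_apply]

theorem pauli_sq (a : Fin 4) : pauli a * pauli a = 1 := by
  fin_cases a <;> ext i j <;> fin_cases i <;> fin_cases j <;> simp [pauli, Matrix.mul_apply]

theorem pauli_mul (a b : Fin 4) :
    ∃ (c : ℂ) (e : Fin 4), c ^ 4 = 1 ∧ pauli a * pauli b = c • pauli e := by
  have hI : (-Complex.I) ^ 4 = 1 := by rw [neg_pow, Complex.I_pow_four]; norm_num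
  have h : pauli a * pauli b =
      (![![1, 1, 1, 1], ![1, 1, Complex.I, -Complex.I], ![1, -Complex.I, 1, Complex.I],
        ![1, Complex.I, -Complex.I, 1]] : Fin 4 → Fin 4 → ℂ) a b •
      pauli ((![![0, 1, 2, 3], ![1, 0, 3, 2], ![2, 3, 0, 1], ![3, 2, 1, 0]] :
        Fin 4 → Fin 4 → Fin 4) a b) := by
    fin_cases a <;> fin_cases b <;> ext i j <;> fin_cases i <;> fin_cases j <;>
      simp [pauli, Matrix.mul_apply]
  refine ⟨_, _, ?_, h⟩
  fin_cases a <;> fin_cases b <;> simp [hI, Complex.I_pow_four]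

theorem pauliString_star {d : ℕ} (s : Fin d → Fin 4) : star (pauliString s) = pauliString s := by
  simp [pauliString, tensor_star, pauli_star]

theorem pauliString_sq {d : ℕ} (s : Fin d → Fin 4) : pauliString s * pauliString s = 1 := by
  simp [pauliString, tensor_mul, pauli_sq, tensor_one]

theorem pauliString_mul {d : ℕ} (s t : Fin d → Fin 4) :
    ∃ (c : ℂ) (r : Fin d → Fin 4), c ^ 4 = 1 ∧
      pauliString s * pauliString t = c • pauliString r := by
  choose c e hc h using pauli_mul
  refine ⟨∏ k, c (s k) (t k), fun k => e (s k) (t k), ?_, ?_⟩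
  · rw [← Finset.prod_pow]; simp [hc]
  · simp only [pauliString, tensor_mul, h, tensor_smul]

/-- The `d`-qubit Pauli group: Pauli strings with a phase in `{1, -1, i, -i}`. -/
def pauliGroup (d : ℕ) : Subgroup (U d) where
  carrier := {V | ∃ (c : ℂ) (s : Fin d → Fin 4), c ^ 4 = 1 ∧ (V : Mat d) = c • pauliString s}
  one_mem' := ⟨1, fun _ => 0, by norm_num, by simp [pauliString, pauli, tensor_one]⟩
  mul_mem' := by
    rintro V W ⟨c, s, hc, hV⟩ ⟨e, t, he, hW⟩
    obtain ⟨f, r, hf, h⟩ := pauliString_mul s t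
    refine ⟨c * e * f, r, by simp [mul_pow, hc, he, hf], ?_⟩
    rw [Matrix.UnitaryGroup.mul_val, hV, hW, Matrix.smul_mul, Matrix.mul_smul, h, smul_smul,
      smul_smul]
  inv_mem' := by
    rintro V ⟨c, s, hc, hV⟩
    refine ⟨star c, s, by rw [← star_pow, hc, star_one], ?_⟩
    rw [Matrix.UnitaryGroup.inv_val, hV, star_smul, pauliString_star]

/-- The `d`-qubit Clifford group: the normalizer of the Pauli group in the unitary group. -/
def cliffordGroup (d : ℕ) : Subgroup (U d) := Subgroup.normalizer (pauliGroup d : Set (U d))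

/-- The global phases `c • 1` in the unitary group. -/
def globalPhases (d : ℕ) : Subgroup (U d) where
  carrier := {V | ∃ c : ℂ, (V : Mat d) = c • (1 : Mat d)}
  one_mem' := ⟨1, by simp⟩
  mul_mem' := by
    rintro V W ⟨c, hV⟩ ⟨e, hW⟩
    exact ⟨c * e, by
      rw [Matrix.UnitaryGroup.mul_val, hV, hW, Matrix.smul_mul, Matrix.mul_smul, mul_one,
        smul_smul]⟩
  inv_mem' := by
    rintro V ⟨c, hV⟩
    exact ⟨star c, by rw [Matrix.UnitaryGroup.inv_val, hV, star_smul, star_one]⟩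

/-- The Clifford group modulo global phases, a finite group. -/
abbrev Clifford (d : ℕ) : Type :=
  cliffordGroup d ⧸ (globalPhases d).subgroupOf (cliffordGroup d)

/-- A unitary matrix representing an element of the Clifford group modulo global phases. The
snapshots and outcome probabilities below do not depend on the phase of the representative. -/
noncomputable def Clifford.rep {d : ℕ} (q : Clifford d) : U d := ((Quotient.out q :) : U d)

theorem exists_pauli_expansion (a b : Fin 2) :
    ∃ c : Fin 4 → ℂ, Matrix.single a b (1 : ℂ) = ∑ k, c k • pauli k := by
  have h2 : (2 : ℂ)⁻¹ + 2⁻¹ = 1 := by norm_num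
  have hI : Complex.I * 2⁻¹ * Complex.I = -2⁻¹ := by
    rw [mul_right_comm, Complex.I_mul_I]; ring
  fin_cases a <;> fin_cases b
  · refine ⟨![1 / 2, 0, 0, 1 / 2], ?_⟩
    ext i j; fin_cases i <;> fin_cases j <;> simp [pauli, Fin.sum_univ_four, h2]
  · refine ⟨![0, 1 / 2, Complex.I / 2, 0], ?_⟩
    ext i j; fin_cases i <;> fin_cases j <;>
      simp [pauli, Fin.sum_univ_four, div_eq_mul_inv, h2, hI]
  · refine ⟨![0, 1 / 2, -Complex.I / 2, 0], ?_⟩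
    ext i j; fin_cases i <;> fin_cases j <;>
      simp [pauli, Fin.sum_univ_four, div_eq_mul_inv, h2, hI]
  · refine ⟨![1 / 2, 0, 0, -1 / 2], ?_⟩
    ext i j; fin_cases i <;> fin_cases j <;>
      simp [pauli, Fin.sum_univ_four, div_eq_mul_inv, h2]

theorem mem_globalPhases_of_commute {d : ℕ} (V : U d)
    (h : ∀ s : Fin d → Fin 4, Commute (V : Mat d) (pauliString s)) : V ∈ globalPhases d := by
  have hs : ∀ x y : Bits d, Commute (Matrix.single x y (1 : ℂ)) (V : Mat d) := by
    intro x y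
    choose c hc using exists_pauli_expansion
    have hexp : Matrix.single x y (1 : ℂ) =
        ∑ s : Fin d → Fin 4, (∏ k, c (x k) (y k) (s k)) • pauliString s := by
      have h1 : Matrix.single x y (1 : ℂ) =
          tensor fun k => Matrix.single (x k) (y k) (1 : ℂ) := by
        ext u v
        simp only [tensor, Matrix.of_apply, Matrix.single_apply, Finset.prod_ite_zero]
        simp [funext_iff, forall_and]
      rw [h1]
      ext u v
      simp only [tensor, Matrix.of_apply, hc, Matrix.sum_apply, Matrix.smul_apply, pauliString,
        smul_eq_mul, ← Finset.prod_mul_distrib]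
      rw [Finset.prod_univ_sum, Fintype.piFinset_univ]
    rw [hexp]
    exact Commute.sum_left _ _ _ fun s _ => (h s).symm.smul_left _
  obtain ⟨c, hc⟩ := Matrix.mem_range_scalar_iff_commute_single'.mpr hs
  refine ⟨c, ?_⟩
  rw [← hc, Matrix.scalar_apply, Matrix.smul_one_eq_diagonal]

theorem pauliGroup_finite (d : ℕ) : (pauliGroup d : Set (U d)).Finite := by
  have h4 : {c : ℂ | c ^ 4 = 1}.Finite := by
    refine (Polynomial.nthRoots 4 (1 : ℂ)).toFinset.finite_toSet.subset fun c hc => ?_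
    simpa using hc
  have : ((fun p : ℂ × (Fin d → Fin 4) => p.1 • pauliString p.2) ''
      ({c : ℂ | c ^ 4 = 1} ×ˢ Set.univ)).Finite := (h4.prod Set.finite_univ).image _
  refine Set.Finite.of_finite_image (f := fun V : U d => (V : Mat d)) (this.subset ?_)
    Subtype.val_injective.injOn
  rintro _ ⟨V, ⟨c, s, hc, hV⟩, rfl⟩
  exact ⟨(c, s), ⟨hc, trivial⟩, hV.symm⟩

instance (d : ℕ) : Finite (Clifford d) := by
  have hP : ∀ s : Fin d → Fin 4, pauliString s ∈ Matrix.unitaryGroup (Bits d) ℂ := fun s =>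
    Matrix.mem_unitaryGroup_iff.mpr (by rw [pauliString_star, pauliString_sq])
  let P : (Fin d → Fin 4) → U d := fun s => ⟨pauliString s, hP s⟩
  have hPm : ∀ s, P s ∈ pauliGroup d := fun s => ⟨1, s, by norm_num, by simp [P]⟩
  have : Finite (pauliGroup d) := (pauliGroup_finite d).to_subtype
  let F : Clifford d → ((Fin d → Fin 4) → pauliGroup d) := fun q s =>
    ⟨(Quotient.out q : cliffordGroup d).1 * P s * (Quotient.out q : cliffordGroup d).1⁻¹,
      (Subgroup.mem_normalizer_iff.mp (Quotient.out q : cliffordGroup d).2 _).mp (hPm s)⟩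
  refine Finite.of_injective F fun q r hqr => ?_
  rw [← Quotient.out_eq q, ← Quotient.out_eq r]
  refine QuotientGroup.eq.mpr ?_
  rw [Subgroup.mem_subgroupOf]
  refine mem_globalPhases_of_commute _ fun s => ?_
  have h := congrArg Subtype.val (congrFun hqr s)
  simp only [F] at h
  set V := (Quotient.out q : cliffordGroup d).1
  set W := (Quotient.out r : cliffordGroup d).1
  have hc : (V⁻¹ * W) * P s = P s * (V⁻¹ * W) := by
    have h' : V * P s = W * P s * W⁻¹ * V := by rw [← h]; group
    calc (V⁻¹ * W) * P s = V⁻¹ * (W * P s * W⁻¹) * W := by group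
      _ = P s * (V⁻¹ * W) := by rw [← h]; group
  exact congrArg Subtype.val hc

noncomputable instance (d : ℕ) : Fintype (Clifford d) := Fintype.ofFinite _

/-! ### Randomized measurements

An ensemble of unitary matrices is a finite family `V : ι → U d`; a random unitary is drawn by
choosing the index uniformly in `ι`. -/

/-- The joint Clifford ensemble: the full `d`-qubit Clifford group. -/
noncomputable def jointClifford (d : ℕ) : Clifford d → U d := Clifford.rep

/-- A `2 × 2` matrix indexed by bit strings of length one, as a matrix indexed by bits. -/
def toQubit (A : Mat 1) : Matrix (Fin 2) (Fin 2) ℂ :=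
  A.submatrix (fun b _ => b) (fun b _ => b)

theorem toQubit_unitary (A : U 1) : toQubit A * star (toQubit A) = 1 := by
  have h := Matrix.mem_unitaryGroup_iff.mp A.2
  have h2 : toQubit A * star (toQubit A) = toQubit ((A : Mat 1) * star (A : Mat 1)) :=
    Matrix.submatrix_mul_equiv (A : Mat 1) (star (A : Mat 1)) (fun b _ => b)
      (Equiv.funUnique (Fin 1) (Fin 2)).symm (fun b _ => b)
  rw [h2, h]
  ext i j
  simp [toQubit, Matrix.one_apply, funext_iff]

/-- The local Clifford ensemble: `U₁ ⊗ ⋯ ⊗ U_d`, one single-qubit Clifford element per qubit. A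
uniform choice of the index makes the factors independent and uniform. -/
noncomputable def localClifford (d : ℕ) (q : Fin d → Clifford 1) : U d :=
  ⟨tensor fun k => toQubit (q k).rep, Matrix.mem_unitaryGroup_iff.mpr (by
    simp [tensor_star, tensor_mul, toQubit_unitary, tensor_one])⟩

/-- The rank-one projection `V† |x⟩⟨x| V`: the element for the outcome `x` of the POVM which
rotates by `V` and measures in the computational basis; also the snapshot of the outcome `x`. -/
def snapshot {d : ℕ} (V : U d) (x : Bits d) : Mat d :=
  star (V : Mat d) * Matrix.single x x 1 * (V : Mat d)

/-- The measurement channel `R(A) = 𝔼_V [∑ₓ Tr(V† |x⟩⟨x| V A) V† |x⟩⟨x| V]`, as a linear map on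
all matrices. -/
noncomputable def channel {d : ℕ} {ι : Type*} [Fintype ι] (V : ι → U d) :
    Module.End ℂ (Mat d) :=
  (Fintype.card ι : ℂ)⁻¹ • ∑ i, ∑ x,
    ((Matrix.traceLinearMap (Bits d) ℂ ℂ).comp
      (LinearMap.mulLeft ℂ (snapshot (V i) x))).smulRight (snapshot (V i) x)

/-- The classical shadow estimate `R⁻¹(V† |x⟩⟨x| V)` of the state, for the sampled index `i` and
the outcome `x`. (`Ring.inverse` is the inverse of an invertible linear map.) -/
noncomputable def shadow {d : ℕ} {ι : Type*} [Fintype ι] (V : ι → U d) (i : ι) (x : Bits d) :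
    Mat d :=
  Ring.inverse (channel V) (snapshot (V i) x)

/-- The estimate `Tr(O R⁻¹(V† |x⟩⟨x| V))` of the expectation value of `O`. -/
noncomputable def estimate {d : ℕ} {ι : Type*} [Fintype ι] (V : ι → U d) (O : Mat d)
    (i : ι) (x : Bits d) : ℂ :=
  (O * shadow V i x).trace

/-- The random variables `I` (sampled index of the ensemble) and `X` (measurement outcome) form a
round of the randomized measurement of the state `ρ`: the index is uniform, and, given the index,
the outcome has the Born distribution. -/
structure IsRound {d : ℕ} {ι : Type*} [Fintype ι] (V : ι → U d) (ρ : Mat d)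
    {Ω : Type*} [MeasurableSpace Ω] (P : Measure Ω) (I : Ω → ι) (X : Ω → Bits d) : Prop where
  measurableSet_index : ∀ i, MeasurableSet (I ⁻¹' {i})
  measurableSet_outcome : ∀ x, MeasurableSet (X ⁻¹' {x})
  uniform : ∀ i, P.real (I ⁻¹' {i}) = (Fintype.card ι : ℝ)⁻¹
  born : ∀ i x, (ProbabilityTheory.cond P (I ⁻¹' {i})).real (X ⁻¹' {x}) =
    (snapshot (V i) x * ρ).trace.re

end ClassicalShadow

namespace ClassicalShadow

/-! Averaged over the index and the Born distribution, the snapshot is the channel applied to `ρ`;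
applying the inverse channel gives `ρ` back, so unbiasedness follows by linearity once the channel
is invertible (`IsRound.integral_estimate`). The remaining work is to compute both channels.

Conjugation by a Clifford unitary maps Pauli strings to multiples of Pauli strings, and dephasing in
the computational basis fixes or kills each of them, so the joint channel is diagonal in the Pauli
basis. It commutes with Clifford conjugations (`channel_jointClifford_conj`), which act transitively
on the non-identity strings (`exists_clifford_conj`), so those share one eigenvalue `f`. The
identity has eigenvalue 1 and the eigenvalues sum to `2 ^ d` (`sum_channel_eigenvalues`). Hence `1 +
(4 ^ d - 1) f = 2 ^ d`, so `f = 1 / (2 ^ d + 1)`. The estimate is then an affine function of a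
diagonal entry of `O` in a rotated basis, a convex combination of eigenvalues of `O`.

The local channel is a tensor power of the one-qubit case, so each factor of the shadow is `3 Π - 1`
for a one-qubit snapshot `Π`. Where `O` acts trivially only the trace of the factor matters, and `Π`
may replace it. Expanding in the rotated product basis gives signed weights of total absolute value
`3 ^ |S|` on diagonal entries bounded by the norm of `O`. -/

variable {d : ℕ}

/-! ### Snapshots and the channel -/

theorem unitary_mul_star (V : U d) : (V : Mat d) * star (V : Mat d) = 1 :=
  Matrix.mem_unitaryGroup_iff.mp V.2

theorem unitary_star_mul (V : U d) : star (V : Mat d) * (V : Mat d) = 1 :=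
  Matrix.mem_unitaryGroup_iff'.mp V.2

theorem trace_snapshot_mul (V : U d) (x : Bits d) (A : Mat d) :
    (snapshot V x * A).trace = ((V : Mat d) * A * star (V : Mat d)) x x := by
  rw [snapshot, Matrix.mul_assoc, Matrix.mul_assoc, Matrix.trace_mul_comm, Matrix.mul_assoc,
    Matrix.trace_single_mul, one_smul]

theorem trace_snapshot (V : U d) (x : Bits d) : (snapshot V x).trace = 1 := by
  have h := trace_snapshot_mul V x 1
  rw [mul_one, mul_one, unitary_mul_star, Matrix.one_apply_eq] at h
  exact h

theorem trace_snapshot_sq (V : U d) (x : Bits d) : (snapshot V x * snapshot V x).trace = 1 := by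
  rw [trace_snapshot_mul, snapshot, ← Matrix.mul_assoc, ← Matrix.mul_assoc, unitary_mul_star,
    one_mul, Matrix.mul_assoc, unitary_mul_star, mul_one, Matrix.single_apply_same]

theorem snapshot_isHermitian (V : U d) (x : Bits d) : (snapshot V x).IsHermitian := by
  rw [Matrix.IsHermitian, ← Matrix.star_eq_conjTranspose, snapshot, star_mul, star_mul, star_star,
    Matrix.mul_assoc, Matrix.star_eq_conjTranspose (Matrix.single x x (1 : ℂ)),
    Matrix.conjTranspose_single, star_one]

theorem sum_snapshot (V : U d) : ∑ x, snapshot V x = 1 := by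
  simp_rw [snapshot, ← Finset.sum_mul, ← Finset.mul_sum]
  rw [Matrix.sum_single_one, mul_one, unitary_star_mul]

/-- The channel of the projective measurement in the basis rotated by `V`. -/
theorem sum_trace_smul_snapshot (V : U d) (A : Mat d) :
    ∑ x, (snapshot V x * A).trace • snapshot V x =
      star (V : Mat d) * Matrix.diagonal ((V : Mat d) * A * star (V : Mat d)).diag *
        (V : Mat d) := by
  have h : Matrix.diagonal ((V : Mat d) * A * star (V : Mat d)).diag =
      ∑ x, ((V : Mat d) * A * star (V : Mat d)) x x • Matrix.single x x (1 : ℂ) := by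
    ext i j
    rw [Matrix.sum_apply, Finset.sum_eq_single i]
    · by_cases hij : i = j <;> simp [hij]
    · intro x _ hx; simp [hx]
    · simp
  rw [h, Finset.mul_sum, Finset.sum_mul]
  refine Finset.sum_congr rfl fun x _ => ?_
  rw [trace_snapshot_mul, snapshot, Matrix.mul_smul, Matrix.smul_mul]

theorem channel_apply {ι : Type*} [Fintype ι] (V : ι → U d) (A : Mat d) :
    channel V A = (Fintype.card ι : ℂ)⁻¹ •
      ∑ i, ∑ x, (snapshot (V i) x * A).trace • snapshot (V i) x := by
  simp [channel, LinearMap.sum_apply]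

theorem isUnit_of_surjective {f : Module.End ℂ (Mat d)} (h : Function.Surjective f) : IsUnit f :=
  (Module.End.isUnit_iff f).mpr ⟨LinearMap.injective_iff_surjective.mpr h, h⟩

theorem inverse_apply_eq {f : Module.End ℂ (Mat d)} (hf : IsUnit f) {A B : Mat d}
    (h : f A = B) : Ring.inverse f B = A := by
  rw [← h, ← Module.End.mul_apply, Ring.inverse_mul_cancel f hf, Module.End.one_apply]

/-! ### Expectation values -/

section Expectation

open Classical in
-- Only the fibres of the index and of the outcome are assumed measurable; as both take finitely
-- many values, this finite sum of indicators suffices for integration.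
theorem comp_eq_sum_indicator {ι Ω : Type*} [Fintype ι] (g : ι → Bits d → ℂ) (C : Ω → ι) (X : Ω → Bits d) :
    (fun ω => g (C ω) (X ω)) =
      fun ω => ∑ i, ∑ x, (C ⁻¹' {i} ∩ X ⁻¹' {x}).indicator (fun _ => g i x) ω := by
  funext ω
  rw [Finset.sum_eq_single (C ω), Finset.sum_eq_single (X ω)]
  · simp
  · intro x _ hx; simp [Ne.symm hx]
  · simp
  · intro i _ hi; exact Finset.sum_eq_zero fun x _ => by simp [Ne.symm hi]
  · simp

variable {ι : Type*} [Fintype ι] {V : ι → U d} {ρ O : Mat d} {Ω : Type*} [MeasurableSpace Ω]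
  {P : Measure Ω} {C : Ω → ι} {X : Ω → Bits d}

theorem IsRound.real_inter [IsProbabilityMeasure P] (h : IsRound V ρ P C X) (i : ι) (x : Bits d) :
    P.real (C ⁻¹' {i} ∩ X ⁻¹' {x}) =
      (Fintype.card ι : ℝ)⁻¹ * (snapshot (V i) x * ρ).trace.re := by
  rw [← h.born, ← h.uniform i, mul_comm]
  rw [Measure.real, Measure.real, Measure.real, ← ENNReal.toReal_mul,
    cond_mul_eq_inter (h.measurableSet_index i)]

theorem IsRound.integrable [IsProbabilityMeasure P] (h : IsRound V ρ P C X)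
    (g : ι → Bits d → ℂ) : Integrable (fun ω => g (C ω) (X ω)) P := by
  rw [comp_eq_sum_indicator]
  exact integrable_finsetSum _ fun i _ => integrable_finsetSum _ fun x _ =>
    (integrable_const _).indicator ((h.measurableSet_index i).inter (h.measurableSet_outcome x))

theorem IsRound.integral [IsProbabilityMeasure P] (h : IsRound V ρ P C X)
    (g : ι → Bits d → ℂ) : ∫ ω, g (C ω) (X ω) ∂P = (Fintype.card ι : ℂ)⁻¹ *
      ∑ i, ∑ x, ((snapshot (V i) x * ρ).trace.re : ℂ) * g i x := by
  have hi : ∀ i x, Integrable ((C ⁻¹' {i} ∩ X ⁻¹' {x}).indicator fun _ => g i x) P := fun i x =>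
    (integrable_const _).indicator ((h.measurableSet_index i).inter (h.measurableSet_outcome x))
  rw [comp_eq_sum_indicator, integral_finsetSum _ fun i _ => integrable_finsetSum _ fun x _ =>
    hi i x]
  rw [Finset.mul_sum]
  refine Finset.sum_congr rfl fun i _ => ?_
  rw [integral_finsetSum _ fun x _ => hi i x, Finset.mul_sum]
  refine Finset.sum_congr rfl fun x _ => ?_
  rw [integral_indicator_const _ ((h.measurableSet_index i).inter (h.measurableSet_outcome x)),
    h.real_inter, Complex.real_smul]
  push_cast
  ring

open scoped ComplexOrder in
-- The trace of a product of two Hermitian matrices is real. This reconciles the real Born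
-- probabilities in `IsRound` with the complex coefficients in `channel`.
theorem IsDensityMatrix.trace_snapshot_mul_re (hρ : IsDensityMatrix ρ) (V : U d) (x : Bits d) :
    ((snapshot V x * ρ).trace.re : ℂ) = (snapshot V x * ρ).trace := by
  refine Complex.conj_eq_iff_re.mp ?_
  rw [starRingEnd_apply, ← Matrix.trace_conjTranspose, Matrix.conjTranspose_mul,
    (snapshot_isHermitian V x).eq, hρ.1.1.eq, Matrix.trace_mul_comm]

theorem IsRound.integral_estimate [IsProbabilityMeasure P] (h : IsRound V ρ P C X)
    (hρ : IsDensityMatrix ρ) (hV : IsUnit (channel V)) :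
    ∫ ω, estimate V O (C ω) (X ω) ∂P = (ρ * O).trace := by
  have key : Ring.inverse (channel V) (channel V ρ) = ρ := inverse_apply_eq hV rfl
  rw [channel_apply] at key
  rw [h.integral (estimate V O), Matrix.trace_mul_comm ρ]
  conv_rhs => rw [← key]
  simp only [map_smul, map_sum, Matrix.mul_smul, Matrix.trace_smul, Matrix.mul_sum,
    Matrix.trace_sum, smul_eq_mul, hρ.trace_snapshot_mul_re, estimate, shadow]

end Expectation

/-! ### Diagonal entries in rotated bases -/

/-- The weights are the squared moduli of row `x` of `V` times the eigenvector unitary; they sum to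
1 because that product is unitary. -/
theorem conj_apply_eq_sum_eigenvalues {O : Mat d} (hO : O.IsHermitian) (V : U d) (x : Bits d) :
    ∃ w : Bits d → ℝ, (∀ i, 0 ≤ w i) ∧ ∑ i, w i = 1 ∧
      ((V : Mat d) * O * star (V : Mat d)) x x = ((∑ i, w i * hO.eigenvalues i : ℝ) : ℂ) := by
  set W : U d := V * hO.eigenvectorUnitary with hW
  have hc : ∀ i, (W : Mat d) x i * star ((W : Mat d) x i) = (Complex.normSq ((W : Mat d) x i) : ℂ) :=
    fun i => Complex.mul_conj _
  refine ⟨fun i => Complex.normSq ((W : Mat d) x i), fun i => Complex.normSq_nonneg _, ?_, ?_⟩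
  · have h := congrFun (congrFun (unitary_mul_star W) x) x
    simp only [Matrix.mul_apply, Matrix.star_apply, hc, Matrix.one_apply_eq] at h
    exact_mod_cast h
  · have h : (V : Mat d) * O * star (V : Mat d) = (W : Mat d) *
        Matrix.diagonal (fun i => (hO.eigenvalues i : ℂ)) * star (W : Mat d) := by
      conv_lhs => rw [hO.spectral_theorem]
      simp only [hW, Unitary.conjStarAlgAut_apply, Matrix.UnitaryGroup.mul_val, star_mul,
        Matrix.mul_assoc]
      rfl
    rw [h, Matrix.mul_apply]
    push_cast
    refine Finset.sum_congr rfl fun i _ => ?_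
    rw [Matrix.mul_diagonal, Matrix.star_apply, ← hc]
    ring

theorem conj_apply_mem_Icc {O : Mat d} (hO : O.IsHermitian) (V : U d) (x : Bits d) :
    ∃ r ∈ Set.Icc (eigMin hO) (eigMax hO),
      ((V : Mat d) * O * star (V : Mat d)) x x = (r : ℂ) := by
  obtain ⟨w, h0, h1, h⟩ := conj_apply_eq_sum_eigenvalues hO V x
  refine ⟨_, ⟨?_, ?_⟩, h⟩
  · calc eigMin hO = ∑ i, w i * eigMin hO := by rw [← Finset.sum_mul, h1, one_mul]
      _ ≤ _ := Finset.sum_le_sum fun i _ =>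
        mul_le_mul_of_nonneg_left (ciInf_le (Set.finite_range _).bddBelow i) (h0 i)
  · calc _ ≤ ∑ i, w i * eigMax hO := Finset.sum_le_sum fun i _ =>
        mul_le_mul_of_nonneg_left (le_ciSup (Set.finite_range _).bddAbove i) (h0 i)
      _ = eigMax hO := by rw [← Finset.sum_mul, h1, one_mul]

open scoped Matrix.Norms.L2Operator in
-- The operator norm is unitarily invariant, and a diagonal entry is one coordinate of the image of
-- a unit basis vector.
theorem norm_conj_apply_le (O : Mat d) (V : U d) (x : Bits d) :
    ‖((V : Mat d) * O * star (V : Mat d)) x x‖ ≤ opNorm O := by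
  have h1 : ‖(V : Mat d) * O * star (V : Mat d)‖ = opNorm O := by
    have h2 : star (V : Mat d) ∈ unitary (Mat d) := Unitary.star_mem V.2
    rw [CStarRing.norm_mul_mem_unitary _ h2, CStarRing.norm_mem_unitary_mul _ V.2]
    rfl
  rw [← h1]
  have h3 := Matrix.l2_opNorm_mulVec ((V : Mat d) * O * star (V : Mat d))
    (EuclideanSpace.single x (1 : ℂ))
  rw [PiLp.norm_single, norm_one, mul_one] at h3
  refine le_trans (le_of_eq ?_) ((PiLp.norm_apply_le _ x).trans h3)
  congr 1
  simp [Matrix.mulVec_single]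

/-! ### Pauli strings -/

/-- Entrywise form of the swap identity: the sum of `P ⊗ P` over the four Pauli matrices is twice
the swap. Completeness and Parseval for Pauli strings follow from it. -/
theorem sum_pauli_mul (a b a' b' : Fin 2) :
    ∑ k, pauli k a b * pauli k a' b' = if a = b' ∧ b = a' then 2 else 0 := by
  fin_cases a <;> fin_cases b <;> fin_cases a' <;> fin_cases b' <;>
    simp [pauli, Fin.sum_univ_four] <;> norm_num

theorem sum_pauliString_mul (x y x' y' : Bits d) :
    ∑ s, pauliString s x y * pauliString s x' y' = if x = y' ∧ y = x' then 2 ^ d else 0 := by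
  simp only [pauliString, tensor, Matrix.of_apply, ← Finset.prod_mul_distrib]
  rw [← Fintype.piFinset_univ, ← Finset.prod_univ_sum (fun _ => Finset.univ)
    fun k a => pauli a (x k) (y k) * pauli a (x' k) (y' k)]
  simp only [sum_pauli_mul, Finset.prod_ite_zero, funext_iff, forall_and, Finset.mem_univ,
    true_imp_iff, Finset.prod_const, Finset.card_univ, Fintype.card_fin]

theorem sum_trace_pauliString_smul (A : Mat d) :
    ∑ s, (pauliString s * A).trace • pauliString s = (2 ^ d : ℂ) • A := by
  ext x y
  simp only [Matrix.sum_apply, Matrix.smul_apply, Matrix.trace, Matrix.diag_apply,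
    Matrix.mul_apply, smul_eq_mul, Finset.sum_mul]
  rw [Finset.sum_comm]
  have : ∀ u, ∑ s, ∑ v, pauliString s u v * A v u * pauliString s x y =
      ∑ v, if u = y ∧ v = x then 2 ^ d * A v u else 0 := fun u => by
    rw [Finset.sum_comm]
    refine Finset.sum_congr rfl fun v _ => ?_
    simp only [mul_right_comm _ (A v u), ← Finset.sum_mul, sum_pauliString_mul, ite_mul, zero_mul]
  simp [this, ite_and]

theorem sum_trace_pauliString_mul (A B : Mat d) :
    ∑ s, (pauliString s * A).trace * (pauliString s * B).trace = 2 ^ d * (A * B).trace := by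
  have h := congrArg (fun M => (M * B).trace) (sum_trace_pauliString_smul A)
  simpa [Finset.sum_mul, Matrix.trace_sum] using h

theorem pauliString_zero : pauliString (0 : Fin d → Fin 4) = 1 := by
  simp [pauliString, pauli, tensor_one]

theorem pauliString_ne_zero (s : Fin d → Fin 4) : pauliString s ≠ 0 := fun h => by
  simpa [h] using pauliString_sq s

theorem trace_one_mat : (1 : Mat d).trace = 2 ^ d := by simp

/-- Dephasing fixes `I` and `Z`, which are diagonal, and kills `X` and `Y`, whose diagonals vanish.
-/
theorem diagonal_diag_pauli (a : Fin 4) : ∃ e : ℂ, Matrix.diagonal (pauli a).diag = e • pauli a := by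
  refine ⟨![1, 0, 0, 1] a, ?_⟩
  fin_cases a <;> ext i j <;> fin_cases i <;> fin_cases j <;> simp [pauli]

theorem diagonal_diag_tensor (A : Fin d → Matrix (Fin 2) (Fin 2) ℂ) :
    Matrix.diagonal (tensor A).diag = tensor fun k => Matrix.diagonal (A k).diag := by
  ext x y
  simp only [tensor, Matrix.diagonal_apply, Matrix.diag_apply, Matrix.of_apply,
    Finset.prod_ite_zero, funext_iff, Finset.mem_univ, true_imp_iff]

theorem diagonal_diag_pauliString (s : Fin d → Fin 4) :
    ∃ e : ℂ, Matrix.diagonal (pauliString s).diag = e • pauliString s := by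
  choose e he using diagonal_diag_pauli
  exact ⟨∏ k, e (s k), by rw [pauliString, diagonal_diag_tensor, ← tensor_smul]; simp only [he]⟩

/-- A Pauli string as a unitary matrix. -/
def pauliUnitary (s : Fin d → Fin 4) : U d :=
  ⟨pauliString s, Matrix.mem_unitaryGroup_iff.mpr (by rw [pauliString_star, pauliString_sq])⟩

theorem pauliUnitary_mem (s : Fin d → Fin 4) : pauliUnitary s ∈ pauliGroup d :=
  ⟨1, s, by norm_num, by simp [pauliUnitary]⟩

theorem exists_conj_pauliString {V : U d} (hV : V ∈ cliffordGroup d) (s : Fin d → Fin 4) :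
    ∃ (c : ℂ) (t : Fin d → Fin 4),
      (V : Mat d) * pauliString s * star (V : Mat d) = c • pauliString t := by
  obtain ⟨c, t, -, h⟩ := (Subgroup.mem_normalizer_iff.mp hV _).mp (pauliUnitary_mem s)
  exact ⟨c, t, h⟩

/-- Rotating by `V` gives a multiple of a Pauli string, dephasing rescales it, and rotating back
restores the original string. -/
theorem sum_snapshot_pauliString {V : U d} (hV : V ∈ cliffordGroup d) (s : Fin d → Fin 4) :
    ∃ e : ℂ, ∑ x, (snapshot V x * pauliString s).trace • snapshot V x = e • pauliString s := by
  obtain ⟨c, t, h⟩ := exists_conj_pauliString hV s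
  obtain ⟨e, he⟩ := diagonal_diag_pauliString t
  refine ⟨e, ?_⟩
  rw [sum_trace_smul_snapshot, h, Matrix.diag_smul, Matrix.diagonal_smul, he, smul_comm, ← h,
    Matrix.mul_smul, Matrix.smul_mul]
  congr 1
  rw [← Matrix.mul_assoc, ← Matrix.mul_assoc, unitary_star_mul, one_mul, Matrix.mul_assoc,
    unitary_star_mul, mul_one]

/-- Pauli strings are eigenvectors of the channel of an ensemble of Clifford unitaries. -/
theorem channel_pauliString {ι : Type*} [Fintype ι] {V : ι → U d} (hV : ∀ i, V i ∈ cliffordGroup d)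
    (s : Fin d → Fin 4) : ∃ f : ℂ, channel V (pauliString s) = f • pauliString s := by
  choose e he using fun i => sum_snapshot_pauliString (hV i) s
  refine ⟨(Fintype.card ι : ℂ)⁻¹ * ∑ i, e i, ?_⟩
  rw [channel_apply]
  simp only [he, ← Finset.sum_smul, smul_smul]

theorem channel_one {ι : Type*} [Fintype ι] [Nonempty ι] (V : ι → U d) : channel V 1 = 1 := by
  rw [channel_apply]
  simp only [mul_one, trace_snapshot, one_smul, sum_snapshot, Finset.sum_const, Finset.card_univ]
  rw [← Nat.cast_smul_eq_nsmul ℂ, smul_smul, inv_mul_cancel₀ (by simp), one_smul]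

/-- This is the trace of the channel as a linear map. By Parseval each snapshot contributes the
trace of its square, which is 1, and there are `2 ^ d` outcomes per unitary. -/
theorem sum_channel_eigenvalues {ι : Type*} [Fintype ι] [Nonempty ι] {V : ι → U d}
    {f : (Fin d → Fin 4) → ℂ} (hf : ∀ s, channel V (pauliString s) = f s • pauliString s) :
    ∑ s, f s = 2 ^ d := by
  have h1 : ∀ s, 2 ^ d * f s = (pauliString s * channel V (pauliString s)).trace := fun s => by
    rw [hf, Matrix.mul_smul, pauliString_sq, Matrix.trace_smul, trace_one_mat, smul_eq_mul,
      mul_comm]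
  have h2 : (2 : ℂ) ^ d * ∑ s, f s = 2 ^ d * 2 ^ d := by
    rw [Finset.mul_sum]
    simp only [h1, channel_apply, Matrix.mul_smul, Matrix.mul_sum, Matrix.trace_smul,
      Matrix.trace_sum, smul_eq_mul]
    rw [← Finset.mul_sum, Finset.sum_comm]
    have h3 : ∀ i, ∑ s, ∑ x, (snapshot (V i) x * pauliString s).trace *
        (pauliString s * snapshot (V i) x).trace = 2 ^ d * 2 ^ d := fun i => by
      rw [Finset.sum_comm]
      simp only [Matrix.trace_mul_comm (snapshot (V i) _), sum_trace_pauliString_mul,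
        trace_snapshot_sq]
      simp [mul_comm]
    simp [h3]
  exact mul_left_cancel₀ (pow_ne_zero d two_ne_zero) h2

/-! ### Covariance of the joint Clifford channel -/

theorem snapshot_mul (V W : U d) (x : Bits d) :
    snapshot (V * W) x = star (W : Mat d) * snapshot V x * (W : Mat d) := by
  simp only [snapshot, Matrix.UnitaryGroup.mul_val, star_mul, Matrix.mul_assoc]

theorem snapshot_eq_of_mem_globalPhases {V W : U d} (h : V⁻¹ * W ∈ globalPhases d) (x : Bits d) :
    snapshot V x = snapshot W x := by
  obtain ⟨c, hc⟩ := h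
  have hcc : star c * c = 1 := by
    have h1 := congrFun (congrFun (unitary_star_mul (V⁻¹ * W)) x) x
    rw [hc, star_smul, star_one, Matrix.smul_mul, one_mul, smul_smul, Matrix.smul_apply,
      Matrix.one_apply_eq, smul_eq_mul, mul_one] at h1
    exact h1
  rw [show W = V * (V⁻¹ * W) by group, snapshot_mul, hc, star_smul, star_one, Matrix.mul_smul,
    Matrix.smul_mul, one_mul, mul_one, smul_smul, mul_comm, hcc, one_smul]

theorem rep_mem (q : Clifford d) : q.rep ∈ cliffordGroup d := (Quotient.out q).2

/-- Scalars are central. Normality makes `Clifford d` a group, so that averages over it can be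
translated. -/
instance : ((globalPhases d).subgroupOf (cliffordGroup d)).Normal := by
  refine ⟨fun V hV W => ?_⟩
  rw [Subgroup.mem_subgroupOf] at hV ⊢
  obtain ⟨c, hc⟩ := hV
  refine ⟨c, ?_⟩
  rw [Subgroup.coe_mul, Subgroup.coe_mul, Matrix.UnitaryGroup.mul_val, Matrix.UnitaryGroup.mul_val,
    hc, Matrix.mul_smul, Matrix.smul_mul, mul_one, ← Matrix.UnitaryGroup.mul_val,
    ← Subgroup.coe_mul, mul_inv_cancel]
  rfl

/-- Chosen representatives are multiplicative only up to a global phase, which snapshots do not see.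
-/
theorem snapshot_rep_mul (q : Clifford d) (W : cliffordGroup d) (x : Bits d) :
    snapshot (Clifford.rep (q * (QuotientGroup.mk W : Clifford d))) x =
      snapshot (q.rep * (W : U d)) x := by
  refine snapshot_eq_of_mem_globalPhases (d := d) ?_ x
  have h : (QuotientGroup.mk (Quotient.out (q * (QuotientGroup.mk W : Clifford d))) : Clifford d) =
      QuotientGroup.mk (Quotient.out q * W) := by
    rw [QuotientGroup.mk_mul]
    exact (Quotient.out_eq _).trans (congrArg (· * _) (Quotient.out_eq q).symm)
  have h2 := QuotientGroup.eq.mp h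
  rw [Subgroup.mem_subgroupOf] at h2
  exact h2

theorem channel_jointClifford_conj (W : cliffordGroup d) (A : Mat d) :
    channel (jointClifford d) ((W : U d) * A * star ((W : U d) : Mat d)) =
      (W : U d) * channel (jointClifford d) A * star ((W : U d) : Mat d) := by
  set w : Mat d := ((W : U d) : Mat d) with hw
  have hww : w * star w = 1 := unitary_mul_star _
  have hS : ∀ (q : Clifford d) x,
      w * snapshot (Clifford.rep (q * (QuotientGroup.mk W : Clifford d))) x * star w =
        snapshot q.rep x := fun q x => by
    rw [snapshot_rep_mul, snapshot_mul, ← hw, ← Matrix.mul_assoc, ← Matrix.mul_assoc, hww, one_mul,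
      Matrix.mul_assoc, hww, mul_one]
  have hT : ∀ (q : Clifford d) x,
      (snapshot (Clifford.rep (q * (QuotientGroup.mk W : Clifford d))) x * A).trace =
        (snapshot q.rep x * (w * A * star w)).trace := fun q x => by
    rw [snapshot_rep_mul, snapshot_mul, ← hw, ← Matrix.mul_assoc, Matrix.trace_mul_comm _ (star w)]
    simp only [Matrix.mul_assoc]
  rw [channel_apply, channel_apply, Matrix.mul_smul, Matrix.smul_mul]
  congr 1
  -- Right translation by the class of `W` permutes the ensemble.
  rw [← Equiv.sum_comp (Equiv.mulRight (QuotientGroup.mk W : Clifford d))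
    (fun q => ∑ x, (snapshot (jointClifford d q) x * A).trace • snapshot (jointClifford d q) x),
    Matrix.mul_sum, Matrix.sum_mul]
  refine Finset.sum_congr rfl fun q _ => ?_
  rw [Matrix.mul_sum, Matrix.sum_mul]
  refine Finset.sum_congr rfl fun x _ => ?_
  rw [Matrix.mul_smul, Matrix.smul_mul, Equiv.coe_mulRight]
  simp only [jointClifford]
  rw [hS, hT]

/-! ### The Clifford group acts transitively on the Pauli strings other than the identity -/

theorem pauli_comm_or_anticomm (a b : Fin 4) :
    ∃ e : ℂ, (e = 1 ∨ e = -1) ∧ pauli a * pauli b = e • (pauli b * pauli a) := by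
  refine ⟨![![1, 1, 1, 1], ![1, 1, -1, -1], ![1, -1, 1, -1], ![1, -1, -1, 1]] a b, ?_, ?_⟩
  · fin_cases a <;> fin_cases b <;> simp
  · fin_cases a <;> fin_cases b <;> ext i j <;> fin_cases i <;> fin_cases j <;>
      simp [pauli, Matrix.mul_apply]

theorem pauli_anticomm {a b : Fin 4} (ha : a ≠ 0) (hb : b ≠ 0) (hab : a ≠ b) :
    pauli a * pauli b = -(pauli b * pauli a) := by
  fin_cases a <;> fin_cases b <;> first
    | exact absurd rfl ha
    | exact absurd rfl hb
    | exact absurd rfl hab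
    | (ext i j; fin_cases i <;> fin_cases j <;> simp [pauli, Matrix.mul_apply])

theorem pauliString_comm_or_anticomm (s t : Fin d → Fin 4) :
    ∃ e : ℂ, (e = 1 ∨ e = -1) ∧
      pauliString s * pauliString t = e • (pauliString t * pauliString s) := by
  choose e he h using pauli_comm_or_anticomm
  refine ⟨∏ k, e (s k) (t k), ?_, ?_⟩
  · refine Finset.prod_induction _ (fun z : ℂ => z = 1 ∨ z = -1) ?_ (Or.inl rfl) fun k _ => he _ _
    rintro _ _ (rfl | rfl) (rfl | rfl) <;> simp
  · simp only [pauliString, tensor_mul, ← tensor_smul, ← h]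

theorem pauliString_single_anticomm {s : Fin d → Fin 4} {k : Fin d} {a : Fin 4} (hs : s k ≠ 0)
    (ha : a ≠ 0) (h : s k ≠ a) :
    pauliString s * pauliString (Pi.single k a) =
      -(pauliString (Pi.single k a) * pauliString s) := by
  have e0 : ∀ b, pauli b * pauli 0 = pauli 0 * pauli b := fun b => by simp [pauli]
  rw [pauliString, pauliString, tensor_mul, tensor_mul, ← neg_one_smul ℂ (tensor _)]
  -- The sign is carried by the factor at `k` alone.
  have h1 : (∏ j : Fin d, (Pi.mulSingle k (-1 : ℂ) : Fin d → ℂ) j) = -1 := by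
    simp
  rw [← h1, ← tensor_smul]
  congr 1
  funext j
  by_cases hj : j = k
  · subst hj
    simp [pauli_anticomm hs ha h]
  · simp [hj, e0]

theorem pauliString_single_comm {s : Fin d → Fin 4} {k : Fin d} {a : Fin 4} (hs : s k = 0) :
    pauliString s * pauliString (Pi.single k a) = pauliString (Pi.single k a) * pauliString s := by
  have e0 : ∀ b, pauli b * pauli 0 = pauli 0 * pauli b := fun b => by simp [pauli]
  rw [pauliString, pauliString, tensor_mul, tensor_mul]
  congr 1
  funext j
  by_cases hj : j = k
  · subst hj; simp [hs, e0]
  · simp [hj, e0]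

theorem exists_ne_and_ne (a b : Fin 4) : ∃ c, c ≠ 0 ∧ a ≠ c ∧ b ≠ c := by decide +revert

/-- If some site lies in both supports, a single Pauli matrix there, different from both entries,
works. Otherwise take a product of two single-site Paulis, one in each support: each string
anticommutes with one and commutes with the other. -/
theorem exists_anticomm {s t : Fin d → Fin 4} (hs : s ≠ 0) (ht : t ≠ 0) :
    ∃ r, pauliString s * pauliString r = -(pauliString r * pauliString s) ∧
      pauliString t * pauliString r = -(pauliString r * pauliString t) := by
  obtain ⟨k, hk⟩ := Function.ne_iff.mp hs
  obtain ⟨j, hj⟩ := Function.ne_iff.mp ht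
  obtain ⟨a, ha, hsa, hta⟩ := exists_ne_and_ne (s k) (t k)
  obtain ⟨b, hb, hsb, htb⟩ := exists_ne_and_ne (s j) (t j)
  by_cases htk : t k = 0
  · by_cases hsj : s j = 0
    · obtain ⟨c, r, -, hr⟩ := pauliString_mul (Pi.single k a : Fin d → Fin 4) (Pi.single j b)
      have hc : c ≠ 0 := by
        rintro rfl
        have h0 := congrArg (pauliString (Pi.single k a : Fin d → Fin 4) * ·) hr
        simp only [← Matrix.mul_assoc, pauliString_sq, one_mul, zero_smul, mul_zero] at h0
        exact pauliString_ne_zero _ h0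
      have hr' : pauliString r = c⁻¹ •
          (pauliString (Pi.single k a : Fin d → Fin 4) * pauliString (Pi.single j b)) := by
        rw [hr, smul_smul, inv_mul_cancel₀ hc, one_smul]
      have h1 := pauliString_single_anticomm hk ha hsa
      have h2 := pauliString_single_comm (a := b) hsj
      have h3 := pauliString_single_comm (a := a) htk
      have h4 := pauliString_single_anticomm hj hb htb
      refine ⟨r, ?_, ?_⟩
      · rw [hr', Matrix.mul_smul, Matrix.smul_mul, ← smul_neg, ← Matrix.mul_assoc, h1,
          Matrix.neg_mul, Matrix.mul_assoc, h2, Matrix.mul_assoc]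
      · rw [hr', Matrix.mul_smul, Matrix.smul_mul, ← smul_neg, ← Matrix.mul_assoc, h3,
          Matrix.mul_assoc, h4, Matrix.mul_neg, Matrix.mul_assoc]
    · exact ⟨_, pauliString_single_anticomm hsj hb hsb, pauliString_single_anticomm hj hb htb⟩
  · exact ⟨_, pauliString_single_anticomm hk ha hsa, pauliString_single_anticomm htk ha hta⟩

/-- For anticommuting Hermitian involutions `p` and `q`, the matrix `(p + q) / √2` is a Hermitian
unitary whose conjugation exchanges them. -/
theorem exists_clifford_of_anticomm {s t : Fin d → Fin 4}
    (h : pauliString s * pauliString t = -(pauliString t * pauliString s)) :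
    ∃ W ∈ cliffordGroup d,
      (W : Mat d) * pauliString s * star (W : Mat d) = pauliString t := by
  set p := pauliString s with hp
  set q := pauliString t with hq
  have hpp : p * p = 1 := pauliString_sq s
  have hqq : q * q = 1 := pauliString_sq t
  have hqp : q * p = -(p * q) := by rw [h, neg_neg]
  set c : ℂ := ((√2 : ℝ) : ℂ)⁻¹ with hc
  have hcc : c * c = 2⁻¹ := by
    rw [hc, ← mul_inv, ← Complex.ofReal_mul, Real.mul_self_sqrt (by norm_num)]; norm_num
  have hsc : star c = c := by
    rw [hc, star_inv₀]; congr 1; exact Complex.conj_ofReal _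
  set w : Mat d := c • (p + q) with hw
  have hsw : star w = w := by
    rw [hw, star_smul, star_add, hp, hq, pauliString_star, pauliString_star, hsc]
  have hww : w * w = 1 := by
    rw [hw, Matrix.smul_mul, Matrix.mul_smul, smul_smul, hcc, mul_add, add_mul, add_mul, hpp, hqq,
      hqp, show (1 : Mat d) + -(p * q) + (p * q + 1) = (2 : ℂ) • 1 by rw [two_smul]; abel,
      smul_smul]
    norm_num
  clear_value w
  let W : U d := ⟨w, Matrix.mem_unitaryGroup_iff.mpr (by rw [hsw, hww])⟩
  have hWinv : W⁻¹ = W := Subtype.ext (by rw [Matrix.UnitaryGroup.inv_val]; exact hsw)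
  have hconj : ∀ g ∈ pauliGroup d, W * g * W⁻¹ ∈ pauliGroup d := by
    rintro g ⟨e, r, he, hg⟩
    set R := pauliString r with hR
    obtain ⟨α, hα, hα'⟩ := pauliString_comm_or_anticomm r s
    obtain ⟨β, hβ, hβ'⟩ := pauliString_comm_or_anticomm r t
    rw [← hp, ← hR] at hα'
    rw [← hq, ← hR] at hβ'
    -- With `R p = α p R` and `R q = β q R`, this is `(p + q)(α p + β q) R / 2`, expanded using `q p
    -- = -p q`. As the signs agree or are opposite, exactly one of the two terms survives, so the
    -- result is again in the Pauli group.
    have hval : ((W * g * W⁻¹ : U d) : Mat d) =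
        (e * 2⁻¹) • (((α + β) • R) + (β - α) • (p * q * R)) := by
      rw [hWinv, Matrix.UnitaryGroup.mul_val, Matrix.UnitaryGroup.mul_val, hg]
      change w * (e • R) * w = _
      rw [Matrix.mul_smul, Matrix.smul_mul, mul_smul]
      congr 1
      rw [hw, Matrix.smul_mul, Matrix.smul_mul, Matrix.mul_smul, smul_smul, hcc, Matrix.mul_assoc,
        mul_add R, hα', hβ']
      congr 1
      simp only [add_mul, mul_add, Matrix.mul_smul, ← Matrix.mul_assoc, hpp, hqq, hqp, one_mul,
        Matrix.neg_mul]
      module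
    by_cases hαβ : α = β
    · have h4 : α ^ 4 = 1 := by rcases hα with rfl | rfl <;> norm_num
      refine ⟨e * α, r, by rw [mul_pow, he, h4, one_mul], ?_⟩
      rw [hval, ← hαβ]
      module
    · have hb : β = -α := by rcases hα with rfl | rfl <;> rcases hβ with rfl | rfl <;> simp_all
      obtain ⟨f, u, hf, hfu⟩ := pauliString_mul s t
      obtain ⟨f', u', hf', hfu'⟩ := pauliString_mul u r
      have h4 : β ^ 4 = 1 := by rcases hβ with rfl | rfl <;> norm_num
      refine ⟨e * β * f * f', u', by simp [mul_pow, he, h4, hf, hf'], ?_⟩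
      rw [hval, hp, hq, hfu, Matrix.smul_mul, hR, hfu', show α = -β by rw [hb, neg_neg]]
      module
  refine ⟨W, Subgroup.mem_normalizer_iff.mpr fun g => ⟨hconj g, fun hg => ?_⟩, ?_⟩
  -- `W` is an involution, so conjugating twice returns `g`.
  · have h1 := hconj _ hg
    rwa [hWinv, show W * (W * g * W) * W = (W * W) * g * (W * W) by group,
      show W * W = 1 from Subtype.ext hww, one_mul, mul_one] at h1
  · change w * p * star w = q
    rw [hsw, hw, Matrix.smul_mul, Matrix.smul_mul, Matrix.mul_smul, smul_smul, hcc]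
    have hppq : p * (p * q) = q := by rw [← Matrix.mul_assoc, hpp, one_mul]
    simp only [add_mul, mul_add, Matrix.mul_assoc, Matrix.mul_neg, Matrix.neg_mul, hpp, hqp, hqq,
      hppq, mul_one, one_mul, neg_neg]
    module

theorem exists_clifford_conj {s t : Fin d → Fin 4} (hs : s ≠ 0) (ht : t ≠ 0) :
    ∃ W : cliffordGroup d,
      ((W : U d) : Mat d) * pauliString s * star ((W : U d) : Mat d) = pauliString t := by
  obtain ⟨r, h1, h2⟩ := exists_anticomm hs ht
  obtain ⟨W, hW, hWs⟩ := exists_clifford_of_anticomm h1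
  obtain ⟨W', hW', hWt⟩ := exists_clifford_of_anticomm (s := r) (t := t) (by rw [h2, neg_neg])
  refine ⟨⟨W' * W, mul_mem hW' hW⟩, ?_⟩
  rw [← hWt, ← hWs, Matrix.UnitaryGroup.mul_val, star_mul]
  simp only [Matrix.mul_assoc]

/-! ### The joint Clifford channel -/

theorem channel_jointClifford_pauliString {s : Fin d → Fin 4} (hs : s ≠ 0) :
    channel (jointClifford d) (pauliString s) = (2 ^ d + 1 : ℂ)⁻¹ • pauliString s := by
  choose f hf using channel_pauliString (V := jointClifford d) rep_mem
  have hinj : ∀ (a b : ℂ) (t : Fin d → Fin 4), a • pauliString t = b • pauliString t → a = b :=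
    fun a b t h => smul_left_injective ℂ (pauliString_ne_zero t) h
  have h0 : f 0 = 1 := hinj _ _ 0 (by
    rw [← hf, pauliString_zero, channel_one, one_smul])
  have hst : ∀ t, t ≠ 0 → f t = f s := fun t ht => by
    obtain ⟨W, hW⟩ := exists_clifford_conj hs ht
    refine hinj _ _ t ?_
    rw [← hf, ← hW, channel_jointClifford_conj, hf, Matrix.mul_smul, Matrix.smul_mul]
  have hsum := sum_channel_eigenvalues hf
  have h4 : (Fintype.card (Fin d → Fin 4) : ℂ) = 2 ^ d * 2 ^ d := by
    simp [← mul_pow]; norm_num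
  -- A non-identity string exists only if `d > 0`.
  have hd : (2 : ℂ) ^ d - 1 ≠ 0 := by
    have : d ≠ 0 := by
      rintro rfl
      exact hs (Subsingleton.elim _ _)
    rw [sub_ne_zero]
    exact_mod_cast (Nat.one_lt_two_pow this).ne'
  have hd' : (2 : ℂ) ^ d + 1 ≠ 0 := by
    have : (2 : ℕ) ^ d + 1 ≠ 0 := by positivity
    exact_mod_cast this
  rw [hf]
  congr 1
  have h5 : ∑ t, f t = 1 + (2 ^ d * 2 ^ d - 1) * f s := by
    rw [← Finset.add_sum_erase _ _ (Finset.mem_univ 0), h0,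
      Finset.sum_congr rfl fun t ht => hst t (Finset.ne_of_mem_erase ht), Finset.sum_const,
      Finset.card_erase_of_mem (Finset.mem_univ _), nsmul_eq_mul, Finset.card_univ,
      Nat.cast_sub Fintype.card_pos, h4, Nat.cast_one]
  rw [h5] at hsum
  refine eq_inv_of_mul_eq_one_left ?_
  -- `4 ^ d - 1 = (2 ^ d - 1)(2 ^ d + 1)`, and the first factor cancels against `2 ^ d - 1`.
  refine mul_left_cancel₀ hd ?_
  linear_combination hsum

/-- In the Pauli expansion of `A` the identity term is preserved and every other term shrinks by the
common factor. -/
theorem channel_jointClifford (A : Mat d) :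
    channel (jointClifford d) A = (2 ^ d + 1 : ℂ)⁻¹ • (A + A.trace • 1) := by
  have h2 : (2 : ℂ) ^ d ≠ 0 := pow_ne_zero d two_ne_zero
  have hd' : (2 : ℂ) ^ d + 1 ≠ 0 := by
    have : (2 : ℕ) ^ d + 1 ≠ 0 := by positivity
    exact_mod_cast this
  have hA := sum_trace_pauliString_smul A
  refine smul_right_injective _ h2 ?_
  change (2 : ℂ) ^ d • _ = (2 : ℂ) ^ d • _
  rw [← map_smul, ← hA, map_sum, ← Finset.add_sum_erase _ _ (Finset.mem_univ 0),
    Finset.sum_congr rfl fun t ht => by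
      rw [map_smul, channel_jointClifford_pauliString (Finset.ne_of_mem_erase ht), smul_comm],
    ← Finset.smul_sum, map_smul, pauliString_zero, channel_one, one_mul]
  rw [← Finset.add_sum_erase _ _ (Finset.mem_univ 0), pauliString_zero, one_mul] at hA
  rw [eq_sub_of_add_eq' hA]
  match_scalars
  · field_simp
    ring
  · field_simp

theorem channel_jointClifford_inverse (A : Mat d) :
    channel (jointClifford d) ((2 ^ d + 1 : ℂ) • A - A.trace • 1) = A := by
  have hd' : (2 : ℂ) ^ d + 1 ≠ 0 := by
    have : (2 : ℕ) ^ d + 1 ≠ 0 := by positivity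
    exact_mod_cast this
  rw [channel_jointClifford, Matrix.trace_sub, Matrix.trace_smul, Matrix.trace_smul, trace_one_mat]
  match_scalars
  · field_simp
  · simp only [smul_eq_mul]
    field_simp
    ring

theorem isUnit_channel_jointClifford : IsUnit (channel (jointClifford d)) :=
  isUnit_of_surjective fun A => ⟨_, channel_jointClifford_inverse A⟩

theorem estimate_jointClifford (O : Mat d) (q : Clifford d) (x : Bits d) :
    estimate (jointClifford d) O q x =
      (2 ^ d + 1) * ((q.rep : Mat d) * O * star (q.rep : Mat d)) x x - O.trace := by
  rw [estimate, shadow, inverse_apply_eq isUnit_channel_jointClifford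
    (channel_jointClifford_inverse _), trace_snapshot, Matrix.mul_sub, Matrix.trace_sub,
    Matrix.mul_smul, Matrix.trace_smul, Matrix.trace_mul_comm, one_smul, mul_one]
  change (2 ^ d + 1 : ℂ) * (snapshot q.rep x * O).trace - _ = _
  rw [trace_snapshot_mul]

theorem trace_re_of_isHermitian {O : Mat d} (hO : O.IsHermitian) : (O.trace.re : ℂ) = O.trace :=
  Complex.conj_eq_iff_re.mp (by
    rw [starRingEnd_apply, ← Matrix.trace_conjTranspose, hO.eq])

theorem estimate_jointClifford_mem_Icc {O : Mat d} (hO : O.IsHermitian) (q : Clifford d)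
    (x : Bits d) :
    ∃ r ∈ Set.Icc ((2 ^ d + 1) * eigMin hO - O.trace.re) ((2 ^ d + 1) * eigMax hO - O.trace.re),
      estimate (jointClifford d) O q x = (r : ℂ) := by
  obtain ⟨r, ⟨h1, h2⟩, h⟩ := conj_apply_mem_Icc hO q.rep x
  refine ⟨(2 ^ d + 1) * r - O.trace.re, ⟨by gcongr, by gcongr⟩, ?_⟩
  rw [estimate_jointClifford, h, ← trace_re_of_isHermitian hO]
  push_cast
  rw [Complex.ofReal_re]

/-! ### Tensor products -/

theorem tensor_sum {κ : Type*} [Fintype κ] (B : Fin d → κ → Matrix (Fin 2) (Fin 2) ℂ) :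
    (tensor fun k => ∑ j, B k j) = ∑ f : Fin d → κ, tensor fun k => B k (f k) := by
  ext x y
  simp only [tensor, Matrix.sum_apply, Matrix.of_apply]
  rw [Finset.prod_univ_sum, Fintype.piFinset_univ]

theorem trace_tensor (A : Fin d → Matrix (Fin 2) (Fin 2) ℂ) :
    (tensor A).trace = ∏ k, (A k).trace := by
  simp only [tensor, Matrix.trace, Matrix.diag_apply, Matrix.of_apply]
  rw [Finset.prod_univ_sum, Fintype.piFinset_univ]

theorem tensor_single (x y : Bits d) :
    (tensor fun k => Matrix.single (x k) (y k) (1 : ℂ)) = Matrix.single x y 1 := by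
  ext u v
  simp only [tensor, Matrix.of_apply, Matrix.single_apply, Finset.prod_ite_zero]
  simp [funext_iff, forall_and]

/-- The trace of a product with an observable acting trivially on the qubit `k` depends on the
factor at `k` only through its trace. -/
theorem trace_tensor_mul_congr {O : Mat d} {k : Fin d} (hO : ActsTriviallyOn O k)
    {B B' : Fin d → Matrix (Fin 2) (Fin 2) ℂ} (hB : ∀ j, j ≠ k → B j = B' j)
    (hk : (B k).trace = (B' k).trace) : (tensor B * O).trace = (tensor B' * O).trace := by
  obtain ⟨A, hA⟩ := hO
  have key : ∀ B : Fin d → Matrix (Fin 2) (Fin 2) ℂ, (tensor B * O).trace = (B k).trace *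
      ∑ u, ∑ v, (∏ j : {j // j ≠ k}, B j (u j) (v j)) * A v u := fun B => by
    have h : ∀ x y : Bits d, tensor B x y * O y x =
        (B k (x k) (y k) * (1 : Matrix (Fin 2) (Fin 2) ℂ) (y k) (x k)) *
          ((∏ j : {j // j ≠ k}, B j (x j) (y j)) * A (fun j => y j) (fun j => x j)) :=
      fun x y => by
        rw [hA, tensor, Matrix.of_apply, Fintype.prod_eq_mul_prod_subtype_ne _ k]
        ring
    have e1 : ∀ b u, (Equiv.funSplitAt k (Fin 2)).symm (b, u) k = b := fun b u => by simp
    have e2 : ∀ b u (j : {j // j ≠ k}), (Equiv.funSplitAt k (Fin 2)).symm (b, u) j = u j :=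
      fun b u j => by simp [j.2]
    simp only [Matrix.trace, Matrix.diag_apply, Matrix.mul_apply, h]
    -- Bit `k` is split off from both indices; the identity factor of `O` leaves only the terms in
    -- which the two bits agree, and these sum to the trace of `B k`.
    rw [← Equiv.sum_comp (Equiv.funSplitAt k (Fin 2)).symm, Fintype.sum_prod_type, Finset.sum_mul]
    refine Finset.sum_congr rfl fun b _ => ?_
    rw [Finset.mul_sum]
    refine Finset.sum_congr rfl fun u _ => ?_
    rw [← Equiv.sum_comp (Equiv.funSplitAt k (Fin 2)).symm, Fintype.sum_prod_type,
      Finset.sum_eq_single b]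
    · rw [Finset.mul_sum]
      refine Finset.sum_congr rfl fun v _ => ?_
      rw [e1, e1, Matrix.one_apply_eq, mul_one]
      simp only [e2]
    · intro b' _ hb'
      refine Finset.sum_eq_zero fun v _ => ?_
      rw [e1, e1, Matrix.one_apply_ne hb', mul_zero, zero_mul]
    · simp
  have hB' : ∀ j : {j // j ≠ k}, B j = B' j := fun j => hB j j.2
  simp only [key, hk, hB']

/-- The factors outside the support are exchanged one qubit at a time. -/
theorem trace_tensor_mul_congr_of_support {O : Mat d} {B B' : Fin d → Matrix (Fin 2) (Fin 2) ℂ}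
    (hS : ∀ k ∈ support O, B k = B' k) (ht : ∀ k, (B k).trace = (B' k).trace) :
    (tensor B * O).trace = (tensor B' * O).trace := by
  classical
  have h : ∀ T : Finset (Fin d), Disjoint T (support O) →
      (tensor (T.piecewise B' B) * O).trace = (tensor B * O).trace := fun T => by
    induction T using Finset.induction_on with
    | empty => simp
    | insert k T hk ih =>
      intro hT
      rw [Finset.disjoint_insert_left] at hT
      rw [← ih hT.2]
      have htriv : ActsTriviallyOn O k := by
        by_contra hc
        exact hT.1 (by simp [support, hc])
      refine trace_tensor_mul_congr htriv (fun j hj => ?_) ?_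
      · simp [Finset.piecewise, hj]
      · simp [Finset.piecewise, hk, ht]
  rw [← h (support O)ᶜ disjoint_compl_left]
  congr 3
  funext k
  by_cases hk : k ∈ support O
  · simp [Finset.piecewise, hk, hS]
  · simp [Finset.piecewise, hk]

/-! ### Single-qubit snapshots -/

/-- The snapshot of the outcome `b` on a single qubit. -/
def qubitSnapshot (V : U 1) (b : Fin 2) : Matrix (Fin 2) (Fin 2) ℂ :=
  toQubit (snapshot V fun _ => b)

theorem toQubit_mul (A B : Mat 1) : toQubit (A * B) = toQubit A * toQubit B :=
  (Matrix.submatrix_mul_equiv A B (fun b _ => b)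
    (Equiv.funUnique (Fin 1) (Fin 2)).symm (fun b _ => b)).symm

theorem toQubit_one : toQubit 1 = 1 := by
  ext i j
  simp [toQubit, Matrix.one_apply, funext_iff]

theorem toQubit_single (b : Fin 2) :
    toQubit (Matrix.single (fun _ => b) (fun _ => b) 1) = Matrix.single b b 1 := by
  ext i j
  simp [toQubit, Matrix.single_apply, funext_iff]

theorem toQubit_sum {κ : Type*} (s : Finset κ) (A : κ → Mat 1) :
    toQubit (∑ i ∈ s, A i) = ∑ i ∈ s, toQubit (A i) := by
  ext i j
  simp [toQubit, Matrix.sum_apply]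

theorem toQubit_smul (c : ℂ) (A : Mat 1) : toQubit (c • A) = c • toQubit A := rfl

theorem sum_bits_one {M : Type*} [AddCommMonoid M] (f : Bits 1 → M) :
    ∑ x, f x = ∑ b : Fin 2, f fun _ => b :=
  (Equiv.sum_comp (Equiv.funUnique (Fin 1) (Fin 2)).symm f).symm

theorem trace_toQubit (A : Mat 1) : (toQubit A).trace = A.trace :=
  (sum_bits_one fun x => A x x).symm

theorem toQubit_surjective : Function.Surjective toQubit := fun A =>
  ⟨A.submatrix (fun x => x 0) (fun x => x 0), rfl⟩

theorem trace_qubitSnapshot (V : U 1) (b : Fin 2) : (qubitSnapshot V b).trace = 1 := by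
  rw [qubitSnapshot, trace_toQubit, trace_snapshot]

theorem sum_qubitSnapshot (V : U 1) : ∑ b, qubitSnapshot V b = 1 := by
  simp only [qubitSnapshot]
  rw [← toQubit_sum, ← sum_bits_one fun x => snapshot V x, sum_snapshot, toQubit_one]

theorem snapshot_localClifford (q : Fin d → Clifford 1) (x : Bits d) :
    snapshot (localClifford d q) x = tensor fun k => qubitSnapshot (q k).rep (x k) := by
  rw [snapshot, ← tensor_single]
  simp only [localClifford, tensor_star, tensor_mul, qubitSnapshot, snapshot, toQubit_mul,
    toQubit_single]
  rfl

/-- The measurement channel of a single qubit. -/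
theorem qubit_channel (A : Matrix (Fin 2) (Fin 2) ℂ) :
    (Fintype.card (Clifford 1) : ℂ)⁻¹ • ∑ q : Clifford 1, ∑ b,
      (qubitSnapshot q.rep b * A).trace • qubitSnapshot q.rep b =
        (3 : ℂ)⁻¹ • (A + A.trace • 1) := by
  obtain ⟨A, rfl⟩ := toQubit_surjective A
  -- On one qubit this is the joint channel with `d = 1`, whence `2 ^ 1 + 1 = 3`.
  have h := congrArg toQubit (channel_jointClifford A)
  rw [channel_apply] at h
  simp only [toQubit_smul, toQubit_sum, sum_bits_one, pow_one] at h
  simp only [qubitSnapshot, ← toQubit_mul, trace_toQubit]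
  refine h.trans ?_
  rw [show (2 + 1 : ℂ) = 3 by norm_num]
  congr 2
  rw [← toQubit_one]
  rfl

/-! ### The local Clifford channel -/

/-- Independence of the factors: by multilinearity the tensor product of the one-qubit averages is
the average over all index tuples. -/
theorem channel_localClifford_tensor (A : Fin d → Matrix (Fin 2) (Fin 2) ℂ) :
    channel (localClifford d) (tensor A) =
      tensor fun k => (3 : ℂ)⁻¹ • (A k + (A k).trace • 1) := by
  simp only [← qubit_channel]
  rw [tensor_smul, tensor_sum, channel_apply]
  simp only [tensor_sum, tensor_smul, snapshot_localClifford, tensor_mul, trace_tensor]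
  simp

theorem channel_localClifford_inverse (A : Fin d → Matrix (Fin 2) (Fin 2) ℂ) :
    channel (localClifford d) (tensor fun k => (3 : ℂ) • A k - (A k).trace • 1) = tensor A := by
  rw [channel_localClifford_tensor]
  congr 1
  funext k
  rw [Matrix.trace_sub, Matrix.trace_smul, Matrix.trace_smul, Matrix.trace_one, Fintype.card_fin]
  match_scalars
  · norm_num
  · simp only [smul_eq_mul]
    ring

/-- Matrix units are product matrices, so they lie in the range; they span, and surjectivity
suffices in finite dimension. -/
theorem isUnit_channel_localClifford : IsUnit (channel (localClifford d)) := by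
  refine isUnit_of_surjective (LinearMap.range_eq_top.mp (eq_top_iff.mpr fun A _ => ?_))
  rw [Matrix.matrix_eq_sum_single A]
  refine Submodule.sum_mem _ fun x _ => Submodule.sum_mem _ fun y _ => ?_
  rw [show Matrix.single x y (A x y) = A x y • Matrix.single x y (1 : ℂ) by
    rw [Matrix.smul_single, smul_eq_mul, mul_one], ← tensor_single]
  exact Submodule.smul_mem _ _ ⟨_, channel_localClifford_inverse _⟩

theorem estimate_localClifford (O : Mat d) (q : Fin d → Clifford 1) (x : Bits d) :
    estimate (localClifford d) O q x =
      (tensor (fun k => (3 : ℂ) • qubitSnapshot (q k).rep (x k) - 1) * O).trace := by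
  have h := channel_localClifford_inverse fun k => qubitSnapshot (q k).rep (x k)
  simp only [trace_qubitSnapshot, one_smul] at h
  rw [estimate, shadow, snapshot_localClifford, inverse_apply_eq isUnit_channel_localClifford h,
    Matrix.trace_mul_comm]

/-! ### Signed expansion and bound for the local estimate -/

/-- The eigenvalues of the single-qubit factor of the shadow, replaced by those of the snapshot
on the qubits on which the observable acts trivially. -/
noncomputable def shadowCoeff (O : Mat d) (x : Bits d) (k : Fin d) (b : Fin 2) : ℝ :=
  if k ∈ support O then (if b = x k then 2 else -1) else (if b = x k then 1 else 0)

theorem sum_abs_shadowCoeff (O : Mat d) (x : Bits d) (k : Fin d) :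
    ∑ b, |shadowCoeff O x k b| = if k ∈ support O then 3 else 1 := by
  generalize hxk : x k = a
  by_cases hk : k ∈ support O <;> fin_cases a <;>
    simp [shadowCoeff, hk, hxk, Fin.sum_univ_two] <;> norm_num

/-- The two snapshots of a qubit sum to 1, so `3 Π - 1` is twice the observed snapshot minus the
other one. -/
theorem sum_shadowCoeff_smul (O : Mat d) (x : Bits d) (k : Fin d) (V : U 1) :
    ∑ b, (shadowCoeff O x k b : ℂ) • qubitSnapshot V b =
      if k ∈ support O then (3 : ℂ) • qubitSnapshot V (x k) - 1 else qubitSnapshot V (x k) := by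
  have h := sum_qubitSnapshot V
  rw [Fin.sum_univ_two] at h
  rw [← h]
  generalize hxk : x k = a
  by_cases hk : k ∈ support O <;> fin_cases a <;>
    simp [shadowCoeff, hk, hxk, Fin.sum_univ_two] <;> module

theorem estimate_localClifford_eq_sum (O : Mat d) (q : Fin d → Clifford 1) (x : Bits d) :
    estimate (localClifford d) O q x = ∑ y, ((∏ k, shadowCoeff O x k (y k) : ℝ) : ℂ) *
      ((localClifford d q : Mat d) * O * star (localClifford d q : Mat d)) y y := by
  rw [estimate_localClifford, trace_tensor_mul_congr_of_support
    (B' := fun k => ∑ b, (shadowCoeff O x k b : ℂ) • qubitSnapshot (q k).rep b)]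
  · simp only [tensor_sum, tensor_smul, ← snapshot_localClifford, Matrix.sum_mul, Matrix.trace_sum,
      Matrix.smul_mul, Matrix.trace_smul, trace_snapshot_mul, smul_eq_mul, Complex.ofReal_prod]
  · intro k hk
    rw [sum_shadowCoeff_smul, if_pos hk]
  · intro k
    rw [sum_shadowCoeff_smul]
    split_ifs
    · rfl
    -- Off the support the replacement is allowed because the traces agree: `3 - 2 = 1`.
    · rw [Matrix.trace_sub, Matrix.trace_smul, trace_qubitSnapshot, Matrix.trace_one]
      norm_num

theorem estimate_localClifford_mem_Icc {O : Mat d} (hO : O.IsHermitian) (q : Fin d → Clifford 1)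
    (x : Bits d) :
    ∃ r ∈ Set.Icc (-(3 ^ (support O).card * opNorm O)) (3 ^ (support O).card * opNorm O),
      estimate (localClifford d) O q x = (r : ℂ) := by
  choose r _ hr using conj_apply_mem_Icc hO (localClifford d q)
  have hle : ∀ y, |r y| ≤ opNorm O := fun y => by
    have h := norm_conj_apply_le O (localClifford d q) y
    rwa [hr, Complex.norm_real, Real.norm_eq_abs] at h
  refine ⟨∑ y, (∏ k, shadowCoeff O x k (y k)) * r y, ?_, ?_⟩
  · rw [Set.mem_Icc, ← abs_le]
    calc _ ≤ ∑ y : Bits d, |(∏ k, shadowCoeff O x k (y k)) * r y| := Finset.abs_sum_le_sum_abs _ _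
      _ ≤ ∑ y : Bits d, (∏ k, |shadowCoeff O x k (y k)|) * opNorm O :=
        Finset.sum_le_sum fun y _ => by
          rw [abs_mul, Finset.abs_prod]
          exact mul_le_mul_of_nonneg_left (hle y) (Finset.prod_nonneg fun k _ => abs_nonneg _)
      -- The total absolute weight factorizes over qubits: `2 + 1 = 3` on the support and 1
      -- elsewhere.
      _ = (∏ k, ∑ b, |shadowCoeff O x k b|) * opNorm O := by
        rw [← Finset.sum_mul, Finset.prod_univ_sum, Fintype.piFinset_univ]
      _ = 3 ^ (support O).card * opNorm O := by
        simp only [sum_abs_shadowCoeff]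
        rw [Finset.prod_ite_mem, Finset.univ_inter, Finset.prod_const]
  · rw [estimate_localClifford_eq_sum, Complex.ofReal_sum]
    simp only [hr, Complex.ofReal_mul]

end ClassicalShadow

/-! ### Assembly for the two ensembles -/

theorem proposition1 {d : ℕ} {ρ O : ClassicalShadow.Mat d}
    (hρ : ClassicalShadow.IsDensityMatrix ρ) (hO : O.IsHermitian)
    {Ω : Type*} [MeasurableSpace Ω] (P : MeasureTheory.Measure Ω)
    [MeasureTheory.IsProbabilityMeasure P] :
    -- local Clifford measurements
    (IsUnit (ClassicalShadow.channel (ClassicalShadow.localClifford d)) ∧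
      ∀ (C : Ω → Fin d → ClassicalShadow.Clifford 1) (X : Ω → ClassicalShadow.Bits d),
        ClassicalShadow.IsRound (ClassicalShadow.localClifford d) ρ P C X →
        MeasureTheory.Integrable
          (fun ω => ClassicalShadow.estimate (ClassicalShadow.localClifford d) O (C ω) (X ω)) P ∧
        ∫ ω, ClassicalShadow.estimate (ClassicalShadow.localClifford d) O (C ω) (X ω) ∂P
          = (ρ * O).trace ∧
        ∀ᵐ ω ∂P, ∃ r ∈ Set.Icc
            (-(3 ^ (ClassicalShadow.support O).card * ClassicalShadow.opNorm O))
            (3 ^ (ClassicalShadow.support O).card * ClassicalShadow.opNorm O),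
          ClassicalShadow.estimate (ClassicalShadow.localClifford d) O (C ω) (X ω) = (r : ℂ)) ∧
    -- joint Clifford measurements
    (IsUnit (ClassicalShadow.channel (ClassicalShadow.jointClifford d)) ∧
      ∀ (C : Ω → ClassicalShadow.Clifford d) (X : Ω → ClassicalShadow.Bits d),
        ClassicalShadow.IsRound (ClassicalShadow.jointClifford d) ρ P C X →
        MeasureTheory.Integrable
          (fun ω => ClassicalShadow.estimate (ClassicalShadow.jointClifford d) O (C ω) (X ω)) P ∧
        ∫ ω, ClassicalShadow.estimate (ClassicalShadow.jointClifford d) O (C ω) (X ω) ∂P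
          = (ρ * O).trace ∧
        ∀ᵐ ω ∂P, ∃ r ∈ Set.Icc
            ((2 ^ d + 1) * ClassicalShadow.eigMin hO - O.trace.re)
            ((2 ^ d + 1) * ClassicalShadow.eigMax hO - O.trace.re),
          ClassicalShadow.estimate (ClassicalShadow.jointClifford d) O (C ω) (X ω) = (r : ℂ)) := by
  refine ⟨⟨ClassicalShadow.isUnit_channel_localClifford, fun C X h => ⟨?_, ?_, ?_⟩⟩,
    ⟨ClassicalShadow.isUnit_channel_jointClifford, fun C X h => ⟨?_, ?_, ?_⟩⟩⟩
  · exact h.integrable (ClassicalShadow.estimate (ClassicalShadow.localClifford d) O)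
  · exact h.integral_estimate hρ ClassicalShadow.isUnit_channel_localClifford
  -- The bounds hold for every index and outcome, hence at every sample point.
  · exact Filter.Eventually.of_forall fun ω =>
      ClassicalShadow.estimate_localClifford_mem_Icc hO (C ω) (X ω)
  · exact h.integrable (ClassicalShadow.estimate (ClassicalShadow.jointClifford d) O)
  · exact h.integral_estimate hρ ClassicalShadow.isUnit_channel_jointClifford
  · exact Filter.Eventually.of_forall fun ω =>
      ClassicalShadow.estimate_jointClifford_mem_Icc hO (C ω) (X ω)
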